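/- **Theorem.** If there is a multiple $\mathfrak{d}$-pathway, then there is a P-point. Here $f\leq^{*}g$ (for $f,g\in\omega^{\omega}$) means that $f(n)\leq g(n)$ for all but finitely many $n$, and "increasing" means strictly increasing. A *P-point* is a nonprincipal ultrafilter $\mathcal{U}$ on $\omega$ such that every countable $\mathcal{F}\subseteq\mathcal{U}$ has a pseudointersection in $\mathcal{U}$, i.e. there is $B\in\mathcal{U}$ with $B\setminus A$ finite for every $A\in\mathcal{F}$. For a cardinal $\kappa$, $\mathsf{H}(\kappa)$ is the collection of all sets whose transitive closure has size less than $\kappa$. Given a well order $\trianglelefteq$ of $\mathsf{H}(\kappa)$, $\mathsf{Sub}(\kappa)$ is the set of all countable $M\subseteq\mathsf{H}(\kappa)$ such that $(M,\in,\trianglelefteq)$ is an elementary submodel of $(\mathsf{H}(\kappa),\in,\trianglelefteq)$; the *height* of $M\in\mathsf{Sub}(\kappa)$ (for $\kappa>\omega_1$) is the countable ordinal $\delta_M=M\cap\omega_1$. A relation $R\subseteq(\omega^{\omega})^{k}\times\omega^{\omega}$ is *$\leq^{*}$-adequate* if for all $x_1,\dots,x_k\in\omega^{\omega}$ there is $f\in\omega^{\omega}$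 such that $R(x_1,\dots,x_k,g)$ holds for every increasing $g\in\omega^{\omega}$ with $g\nleq^{*}f$. A *multiple $\mathfrak{d}$-pathway* is a pair $(\mathcal{B},\mathcal{S})$ for which there are a regular cardinal $\kappa>\mathfrak{c}$ and a well order $\trianglelefteq$ of $\mathsf{H}(\kappa)$ such that: $\mathcal{B}=\langle f_\alpha\mid\alpha<\omega_1\rangle$ is a sequence of increasing functions in $\omega^{\omega}$; $\mathcal{S}\subseteq\mathsf{Sub}(\kappa)$ is stationary in the family of countable subsets of $\mathsf{H}(\kappa)$; $\mathcal{B}\in M$ for every $M\in\mathcal{S}$; and for every $n\in\omega$, all $M_0,\dots,M_n\in\mathcal{S}$ with $\delta_{M_0}\leq\dots\leq\delta_{M_n}$, every projective and $\leq^{*}$-adequate relation $R\subseteq(\omega^{\omega})^{n+2}$ with $R\in M_n$, and all $x_i\in M_i\cap\omega^{\omega}$ ($i\leq n$), the relation $R(x_0,\dots,x_n,f_{\delta_{M_n}})$ holds. -/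

import Mathlib

open Cardinal Ordinal Filter

universe u

namespace DPathway

/-! ### Hereditarily small sets and their elementary submodels -/

/-- The transitive closure of `x`: all `y` with `y ∈ ⋯ ∈ x`. -/
def trcl (x : ZFSet.{u}) : Set ZFSet.{u} :=
  {y | Relation.TransGen (fun a b : ZFSet.{u} => a ∈ b) y x}

/-- `H(κ)`: the sets whose transitive closure has size less than `κ`. -/
def HSet (κ : Cardinal.{u}) : Set ZFSet.{u} :=
  {x | #(trcl x) < Cardinal.lift.{u + 1} κ}

/-- The symbols of the language of set theory with a well order: two binary relation symbols. -/
inductive SetRel : ℕ → Type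
  | mem : SetRel 2
  | lt : SetRel 2

/-- The first-order language with `∈` and a symbol for a well order. -/
def setLanguage : FirstOrder.Language := ⟨fun _ => Empty, SetRel⟩

/-- The structure `(H(κ), ∈, ⊲)`, where `⊲` is (the strict part of) a well order of `H(κ)`. -/
@[reducible] def hStructure (κ : Cardinal.{u}) (lt : HSet κ → HSet κ → Prop) :
    setLanguage.Structure (HSet κ) where
  funMap := fun f => Empty.elim f
  RelMap := fun r =>
    match r with
    | SetRel.mem => fun v => (v 0 : ZFSet.{u}) ∈ (v 1 : ZFSet.{u})
    | SetRel.lt => fun v => lt (v 0) (v 1)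

/-- `Sub(κ)`: the countable `M ⊆ H(κ)` such that `(M, ∈, ⊲)` is an elementary submodel of
`(H(κ), ∈, ⊲)`. -/
def Sub (κ : Cardinal.{u}) (lt : HSet κ → HSet κ → Prop) : Set (Set ZFSet.{u}) :=
  letI := hStructure κ lt
  {M | M.Countable ∧
    ∃ N : setLanguage.ElementarySubstructure (HSet κ), M = Subtype.val '' (N : Set (HSet κ))}

/-- The height `δ_M = M ∩ ω₁` of a model, computed as the least ordinal that is not a member of
`M ∩ ω₁` (for a countable elementary submodel `M` of `H(κ)`, `κ > ω₁`, the set `M ∩ ω₁` is a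
countable ordinal, and so equals the least ordinal that is not a member of it). -/
noncomputable def height (M : Set ZFSet.{u}) : Ordinal.{u} :=
  sInf {α : Ordinal.{u} | ¬ (α < ω₁ ∧ α.toZFSet ∈ M)}

/-! ### Stationary families of countable sets -/

/-- `C` is a club in the family of all countable subsets of `X`: it consists of countable subsets
of `X`, it is cofinal, and it is closed under unions of increasing `ω`-sequences. -/
structure IsClubCountable {α : Type*} (X : Set α) (C : Set (Set α)) : Prop where
  countable_subset : ∀ A ∈ C, A.Countable ∧ A ⊆ X
  cofinal : ∀ A : Set α, A.Countable → A ⊆ X → ∃ B ∈ C, A ⊆ B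
  closed : ∀ c : ℕ → Set α, (∀ n, c n ∈ C) → Monotone c → (⋃ n, c n) ∈ C

/-- `S` is stationary in the family of all countable subsets of `X`: it meets every club. -/
def IsStationaryCountable {α : Type*} (X : Set α) (S : Set (Set α)) : Prop :=
  ∀ C : Set (Set α), IsClubCountable X C → (S ∩ C).Nonempty

/-! ### Reals, relations and sequences of reals as sets -/

/-- The natural number `n` as a von Neumann ordinal. -/
noncomputable def natSet (n : ℕ) : ZFSet.{u} := (n : Ordinal.{u}).toZFSet

/-- A function `x : ω → ω` as a set of ordered pairs. -/
noncomputable def realSet (x : ℕ → ℕ) : ZFSet.{u} :=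
  ZFSet.range fun n : ℕ => ZFSet.pair (natSet n) (natSet (x n))

/-- A `k`-tuple of elements of `ω^ω`, as a function with domain `k`. -/
noncomputable def tupleSet {k : ℕ} (t : Fin k → ℕ → ℕ) : ZFSet.{u} :=
  ZFSet.range fun i : Fin k => ZFSet.pair (natSet i) (realSet (t i))

/-- A relation `R ⊆ (ω^ω)^k` as a set of tuples. -/
noncomputable def relSet {k : ℕ} (R : Set (Fin k → ℕ → ℕ)) : ZFSet.{u} :=
  ZFSet.range fun t : R => tupleSet (t : Fin k → ℕ → ℕ)

/-- The sequence `⟨f_α : α < ω₁⟩` of elements of `ω^ω`, as a function with domain `ω₁`.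
Only the values of `f` below `ω₁` are used. -/
noncomputable def seqSet (f : Ordinal.{u} → ℕ → ℕ) : ZFSet.{u} :=
  ZFSet.range fun α : Set.Iio (ω₁ : Ordinal.{u}) =>
    ZFSet.pair (α : Ordinal.{u}).toZFSet (realSet (f α))

/-! ### Projective and adequate relations -/

/-- The class `Σ¹_{m+1}` of subsets of `(ω^ω)^k`: the class `Σ¹₁` is that of the analytic sets, and
a `Σ¹_{m+2}` set is the projection of the complement of a `Σ¹_{m+1}` subset of `(ω^ω)^k × ω^ω`. -/
def IsSigmaOne : ℕ → ∀ {k : ℕ}, Set (Fin k → ℕ → ℕ) → Prop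
  | 0, _, A => MeasureTheory.AnalyticSet A
  | m + 1, k, A => ∃ C : Set (Fin (k + 1) → ℕ → ℕ), IsSigmaOne m C ∧
      A = {x : Fin k → ℕ → ℕ | ∃ y : ℕ → ℕ, (Fin.snoc x y : Fin (k + 1) → ℕ → ℕ) ∉ C}

/-- A subset of `(ω^ω)^k` is projective if it is `Σ¹_m` for some `m ≥ 1`. -/
def IsProjective {k : ℕ} (A : Set (Fin k → ℕ → ℕ)) : Prop := ∃ m, IsSigmaOne m A

/-- `f ≤* g`: `f n ≤ g n` for all but finitely many `n`. -/
def LeStar (f g : ℕ → ℕ) : Prop := ∀ᶠ n in cofinite, f n ≤ g n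

/-- `R ⊆ (ω^ω)^k × ω^ω` is `≤*`-adequate: for all `x₁, …, x_k` there is `f` such that
`R(x₁, …, x_k, g)` holds for every (strictly) increasing `g` with `g ≰* f`. -/
def IsAdequate {k : ℕ} (R : Set (Fin (k + 1) → ℕ → ℕ)) : Prop :=
  ∀ x : Fin k → ℕ → ℕ, ∃ f : ℕ → ℕ, ∀ g : ℕ → ℕ, StrictMono g → ¬ LeStar g f →
    (Fin.snoc x g : Fin (k + 1) → ℕ → ℕ) ∈ R

/-! ### Multiple `𝔡`-pathways -/

/-- `(⟨f_α : α < ω₁⟩, S)` is a multiple `𝔡`-pathway (with respect to the regular cardinal `κ > 𝔠`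
and the well order `lt` of `H(κ)`). -/
structure IsMultiplePathway (κ : Cardinal.{u}) (lt : HSet κ → HSet κ → Prop)
    (f : Ordinal.{u} → ℕ → ℕ) (S : Set (Set ZFSet.{u})) : Prop where
  regular : κ.IsRegular
  continuum_lt : 𝔠 < κ
  wellOrder : IsWellOrder (HSet κ) lt
  strictMono : ∀ α < (ω₁ : Ordinal.{u}), StrictMono (f α)
  subset_sub : S ⊆ Sub κ lt
  stationary : IsStationaryCountable (HSet κ) S
  seq_mem : ∀ M ∈ S, seqSet f ∈ M
  /-- For every sequence `M₀, …, Mₙ` of models from `S` with nondecreasing heights, every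
  projective `≤*`-adequate relation `R ∈ Mₙ` and all reals `xᵢ ∈ Mᵢ`, the relation
  `R(x₀, …, xₙ, f_{δₙ})` holds, where `δₙ` is the height of `Mₙ`. -/
  rel : ∀ (n : ℕ) (M : Fin (n + 1) → Set ZFSet.{u}), (∀ i, M i ∈ S) →
    (∀ i j : Fin (n + 1), i ≤ j → height (M i) ≤ height (M j)) →
    ∀ R : Set (Fin (n + 2) → ℕ → ℕ), IsProjective R → IsAdequate R →
    relSet R ∈ M (Fin.last n) →
    ∀ x : Fin (n + 1) → ℕ → ℕ, (∀ i, realSet (x i) ∈ M i) →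
      (Fin.snoc x (f (height (M (Fin.last n)))) : Fin (n + 2) → ℕ → ℕ) ∈ R

/-! ### P-points -/

/-- A P-point: a nonprincipal ultrafilter on `ω` such that every countable subfamily has a
pseudointersection in the ultrafilter. -/
def IsPPoint (U : Ultrafilter ℕ) : Prop :=
  (U : Filter ℕ) ≤ cofinite ∧
    ∀ F : Set (Set ℕ), F.Countable → (∀ A ∈ F, A ∈ U) →
      ∃ B ∈ U, ∀ A ∈ F, (B \ A).Finite

end DPathway

/-!
The ultrafilter is built by recursion on the heights of models. Let a real `x` code a sequence
`slice x 0, slice x 1, …` of subsets of `ω`, and for `g : ω → ω` let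
`diag x g = ⋃ₙ (⋂_{m ≤ n} slice x m ∩ [0, g n))`, a pseudointersection of that sequence. At the
height `δ` there is a nonprincipal ultrafilter `stage δ` that contains all the sets added at smaller
heights, and one adds `diag x (f δ)` for every real `x` in a model of height `δ` that codes a
sequence of members of `stage δ`.

That finitely many of the added sets always have infinite intersection (`infinite_of_monotone`) is
where the pathway comes in. Given sequences with infinite finite intersections, also with a further
set `E`, the diagonal sets along `g` have infinite intersection with `E` as soon as `g` is not
bounded by a function `e` choosing points of these intersections. Hence the relation `extRel`
expressing this is Borel and `≤*`-adequate (`isProjective_extRel`, `isAdequate_extRel`), and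
it may be applied to `f δ`, where `δ` is the greatest height concerned: the set `E` is the
intersection of the diagonal sets added at heights `α < δ`, which depends only on reals in models of
smaller height and on the functions `f α`, which lie in a model of height `δ`.

The models are required to contain the relations `extRel`, and to be closed under `α ↦ f α` and
under a simple operation on reals. Such models still contain all reals (`exists_mem_closedModels`),
because the countable subsets of `H(κ)` with these properties that contain a given real form a club
and the family of models is stationary.

A final stage above all heights is a P-point. If a real `x` in a model of height `δ` codes an
enumeration of a countable subfamily, then each of its members belongs to `stage δ`, as otherwise
its complement would be in the final ultrafilter as well; so `diag x (f δ)` was added.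
-/

namespace DPathway

/-! ### Codes for subsets and sequences of subsets of `ω` -/

/-- The `m`-th member of the sequence of subsets of `ω` coded by the real `x`. -/
def slice (x : ℕ → ℕ) (m : ℕ) : Set ℕ := {k | x (Nat.pair m k) ≠ 0}

/-- The diagonal set `⋃ₙ (⋂_{m ≤ n} slice x m ∩ [0, g n))`: a pseudointersection of the sequence
coded by `x`, with the growth of `g` deciding how much of each finite intersection is kept. -/
def diag (x g : ℕ → ℕ) : Set ℕ := {k | ∃ n, k < g n ∧ ∀ m ≤ n, k ∈ slice x m}

/-- A code for the constant sequence with value the complement of `slice x m`. -/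
def complCode (m : ℕ) (x : ℕ → ℕ) : ℕ → ℕ := fun p =>
  if x (Nat.pair m (Nat.unpair p).2) = 0 then 1 else 0

lemma slice_complCode (m : ℕ) (x : ℕ → ℕ) (n : ℕ) : slice (complCode m x) n = (slice x m)ᶜ := by
  ext k
  simp [slice, complCode]

lemma exists_slice_eq (A : ℕ → Set ℕ) : ∃ x : ℕ → ℕ, ∀ m, slice x m = A m := by
  classical
  refine ⟨fun p => if (Nat.unpair p).2 ∈ A (Nat.unpair p).1 then 1 else 0, fun m => ?_⟩
  ext k
  simp [slice]

lemma diag_diff_slice_finite (x g : ℕ → ℕ) (m : ℕ) : (diag x g \ slice x m).Finite := by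
  refine ((Set.finite_Iio m).biUnion fun n _ => Set.finite_Iio (g n)).subset ?_
  rintro k ⟨⟨n, hk, hn⟩, hm⟩
  simp only [Set.mem_iUnion, Set.mem_Iio, exists_prop]
  refine ⟨n, ?_, hk⟩
  by_contra! h
  exact hm (hn m h)

/-! ### The extension relation -/

/-- The intersection of the diagonal sets `diag (v i) (v (N + i))` over the indices `i < N` not
in `D`. -/
def oldSet {N : ℕ} (D : Finset (Fin N)) (v : Fin (N + N) → ℕ → ℕ) : Set ℕ :=
  {k | ∀ i ∉ D, k ∈ diag (v (Fin.castAdd N i)) (v (Fin.natAdd N i))}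

/-- The relation of all `(v, g)` such that, if every finite part of the sequences coded by `v i`
for `i ∈ D` has infinite intersection with `oldSet D v`, then so have their diagonal sets
along `g`. -/
def extRel {N : ℕ} (D : Finset (Fin N)) : Set (Fin (N + N + 1) → ℕ → ℕ) :=
  {w | (∀ n, {k | k ∈ oldSet D (Fin.init w : Fin (N + N) → ℕ → ℕ) ∧
          ∀ i ∈ D, ∀ m ≤ n, k ∈ slice (w (Fin.castSucc (Fin.castAdd N i))) m}.Infinite) →
        {k | k ∈ oldSet D (Fin.init w : Fin (N + N) → ℕ → ℕ) ∧
          ∀ i ∈ D, k ∈ diag (w (Fin.castSucc (Fin.castAdd N i))) (w (Fin.last _))}.Infinite}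

lemma snoc_mem_extRel {N : ℕ} {D : Finset (Fin N)} {v : Fin (N + N) → ℕ → ℕ} {g : ℕ → ℕ} :
    (Fin.snoc v g : Fin (N + N + 1) → ℕ → ℕ) ∈ extRel D ↔
      ((∀ n, {k | k ∈ oldSet D v ∧
          ∀ i ∈ D, ∀ m ≤ n, k ∈ slice (v (Fin.castAdd N i)) m}.Infinite) →
        {k | k ∈ oldSet D v ∧ ∀ i ∈ D, k ∈ diag (v (Fin.castAdd N i)) g}.Infinite) := by
  simp only [extRel, Set.mem_ofPred_eq, Fin.init_snoc, Fin.snoc_castSucc, Fin.snoc_last]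

lemma isProjective_extRel {N : ℕ} (D : Finset (Fin N)) : IsProjective (extRel D) := by
  refine ⟨0, ?_⟩
  have hs : ∀ (j : Fin (N + N + 1)) (m k : ℕ),
      Measurable fun w : Fin (N + N + 1) → ℕ → ℕ => k ∈ slice (w j) m := by
    intro j m k
    have h1 : Measurable fun w : Fin (N + N + 1) → ℕ → ℕ => w j (Nat.pair m k) :=
      (measurable_pi_apply _).comp (measurable_pi_apply j)
    exact (Measurable.of_discrete (f := fun a : ℕ => a ≠ 0)).comp h1
  have hd : ∀ (i j : Fin (N + N + 1)) (k : ℕ),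
      Measurable fun w : Fin (N + N + 1) → ℕ → ℕ => k ∈ diag (w i) (w j) := by
    intro i j k
    refine Measurable.exists fun n => Measurable.and ?_ ?_
    · have h1 : Measurable fun w : Fin (N + N + 1) → ℕ → ℕ => w j n :=
        (measurable_pi_apply _).comp (measurable_pi_apply j)
      exact (Measurable.of_discrete (f := fun a : ℕ => k < a)).comp h1
    · exact Measurable.forall fun m => Measurable.forall fun _ => hs i m k
  have ho : ∀ k : ℕ, Measurable fun w : Fin (N + N + 1) → ℕ → ℕ =>
      k ∈ oldSet D (Fin.init w : Fin (N + N) → ℕ → ℕ) := fun k =>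
    Measurable.forall fun i => Measurable.forall fun _ => hd _ _ k
  have hm : MeasurableSet (extRel D) := by
    refine measurableSet_setOfPred.2 ?_
    simp only [Set.infinite_iff_exists_gt, Set.mem_ofPred_eq]
    refine Measurable.imp ?_ ?_
    · refine Measurable.forall fun n => Measurable.forall fun a => Measurable.exists fun k =>
        Measurable.and (Measurable.and (ho k) ?_) measurable_const
      exact Measurable.forall fun i => Measurable.forall fun _ => Measurable.forall fun m =>
        Measurable.forall fun _ => hs _ m k
    · refine Measurable.forall fun a => Measurable.exists fun k =>
        Measurable.and (Measurable.and (ho k) ?_) measurable_const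
      exact Measurable.forall fun i => Measurable.forall fun _ => hd _ _ k
  exact hm.analyticSet

lemma isAdequate_extRel {N : ℕ} (D : Finset (Fin N)) : IsAdequate (extRel D) := by
  intro v
  by_cases hv : ∀ n, {k | k ∈ oldSet D v ∧
      ∀ i ∈ D, ∀ m ≤ n, k ∈ slice (v (Fin.castAdd N i)) m}.Infinite
  · -- The bound `e n` picks a point above `n` in the `n`-th set, which enters the diagonal sets
    -- along `g` as soon as `e n < g n`.
    choose e he hne using fun n => (hv n).exists_gt n
    refine ⟨e, fun g _ hg => snoc_mem_extRel.2 fun _ => ?_⟩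
    have hinf : {n | ¬ g n ≤ e n}.Infinite := fun h => hg h
    rw [Set.infinite_iff_exists_gt] at hinf ⊢
    intro a
    obtain ⟨n, hn, han⟩ := hinf a
    exact ⟨e n, ⟨(he n).1, fun i hi => ⟨n, not_le.1 hn, (he n).2 i hi⟩⟩, han.trans (hne n)⟩
  · exact ⟨0, fun g _ _ => snoc_mem_extRel.2 fun h => absurd h hv⟩

/-! ### Sets with transitive closure of size at most the continuum -/

/-- A set with at most continuum many elements, all of them with transitive closure of size at most
the continuum, has itself a transitive closure of size at most the continuum. -/
lemma mk_trcl_le {ι : Type} {x : ZFSet.{u}} (f : ι → ZFSet.{u}) (hι : #ι ≤ 𝔠)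
    (hx : ∀ y ∈ x, ∃ i, f i = y) (hf : ∀ i, #(trcl (f i)) ≤ 𝔠) : #(trcl x) ≤ 𝔠 := by
  have hsub : trcl x ⊆ ⋃ i, insert (f i) (trcl (f i)) := by
    intro y hy
    obtain ⟨z, hyz, hz⟩ := Relation.TransGen.tail'_iff.1 hy
    obtain ⟨i, rfl⟩ := hx z hz
    refine Set.mem_iUnion.2 ⟨i, ?_⟩
    rcases Relation.reflTransGen_iff_eq_or_transGen.1 hyz with rfl | h
    · exact Set.mem_insert _ _
    · exact Set.mem_insert_of_mem _ h
  refine (mk_le_mk_of_subset hsub).trans ?_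
  have h := mk_iUnion_le_lift fun i => insert (f i) (trcl (f i))
  rw [Cardinal.lift_uzero] at h
  refine h.trans ?_
  rw [← continuum_mul_self]
  refine mul_le_mul' (by simpa using hι) (ciSup_le' fun i => ?_)
  rw [Cardinal.lift_uzero]
  refine mk_insert_le.trans ?_
  exact add_le_of_le aleph0_le_continuum (hf i) (one_le_aleph0.trans aleph0_le_continuum)

lemma mk_trcl_natSet (n : ℕ) : #(trcl (natSet.{u} n)) ≤ 𝔠 := by
  induction n using Nat.strong_induction_on with
  | _ n ih =>
    refine mk_trcl_le (fun i : Fin n => natSet i) ?_ ?_ fun i => ih i i.2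
    · exact (mk_le_aleph0).trans aleph0_le_continuum
    · intro y hy
      obtain ⟨a, ha, rfl⟩ := mem_toZFSet_iff.1 hy
      obtain ⟨m, rfl⟩ := lt_omega0.1 (ha.trans (natCast_lt_omega0 n))
      exact ⟨⟨m, by exact_mod_cast ha⟩, rfl⟩

lemma mk_trcl_pair {x y : ZFSet.{u}} (hx : #(trcl x) ≤ 𝔠) (hy : #(trcl y) ≤ 𝔠) :
    #(trcl (ZFSet.pair x y)) ≤ 𝔠 := by
  have h2 : ∀ a b : ZFSet.{u}, #(trcl a) ≤ 𝔠 → #(trcl b) ≤ 𝔠 →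
      #(trcl ({a, b} : ZFSet.{u})) ≤ 𝔠 := by
    intro a b ha hb
    refine mk_trcl_le (fun i : Bool => if i then a else b)
      (mk_le_aleph0.trans aleph0_le_continuum) ?_ ?_
    · intro z hz
      rcases ZFSet.mem_pair.1 hz with rfl | rfl
      · exact ⟨true, rfl⟩
      · exact ⟨false, rfl⟩
    · rintro (_ | _) <;> simpa
  refine h2 _ _ ?_ (h2 _ _ hx hy)
  simpa using h2 x x hx hx

lemma mk_trcl_realSet (x : ℕ → ℕ) : #(trcl (realSet.{u} x)) ≤ 𝔠 :=
  mk_trcl_le _ (mk_le_aleph0.trans aleph0_le_continuum) (fun _ => ZFSet.mem_range.1)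
    fun n => mk_trcl_pair (mk_trcl_natSet n) (mk_trcl_natSet (x n))

lemma mk_trcl_relSet {k : ℕ} (R : Set (Fin k → ℕ → ℕ)) : #(trcl (relSet.{u} R)) ≤ 𝔠 := by
  refine mk_trcl_le _ ((mk_set_le R).trans ?_) (fun _ => ZFSet.mem_range.1) fun t =>
    mk_trcl_le _ (mk_le_aleph0.trans aleph0_le_continuum) (fun _ => ZFSet.mem_range.1) fun i =>
      mk_trcl_pair (mk_trcl_natSet i) (mk_trcl_realSet _)
  have h : #(Fin k → ℕ → ℕ) = 𝔠 ^ #(Fin k) := by simp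
  rw [h]
  exact (power_le_power_left continuum_ne_zero mk_le_aleph0).trans_eq continuum_power_aleph0

lemma realSet_injective : Function.Injective realSet.{u} := by
  intro x y hxy
  funext n
  have hn : ZFSet.pair (natSet.{u} n) (natSet (x n)) ∈ realSet.{u} y :=
    hxy ▸ ZFSet.mem_range.2 ⟨n, rfl⟩
  obtain ⟨m, hm⟩ := ZFSet.mem_range.1 hn
  have hinj : Function.Injective natSet.{u} :=
    toZFSet_injective.comp Nat.cast_injective
  obtain ⟨h1, h2⟩ := ZFSet.pair_inj.1 hm
  rw [← hinj h2, hinj h1]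

/-! ### Clubs of countable sets closed under an operation -/

/-- The countable subsets of `X` that include `K` and are closed under `z ↦ Ψ z` form a club. -/
lemma isClubCountable_closed {α : Type*} {X K : Set α} {Ψ : α → Set α} (hK : K.Countable)
    (hKX : K ⊆ X) (hΨ : ∀ z, (Ψ z).Countable) (hΨX : ∀ z, Ψ z ⊆ X) :
    IsClubCountable X {A | (A.Countable ∧ A ⊆ X) ∧ K ⊆ A ∧ ∀ z ∈ A, Ψ z ⊆ A} where
  countable_subset A hA := hA.1
  cofinal A hA hAX := by
    let a : ℕ → Set α := fun n => Nat.rec (A ∪ K) (fun _ B => B ∪ ⋃ z ∈ B, Ψ z) n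
    have ha : ∀ n, (a n).Countable ∧ a n ⊆ X := by
      intro n
      induction n with
      | zero => exact ⟨hA.union hK, Set.union_subset hAX hKX⟩
      | succ n ih =>
        exact ⟨ih.1.union (ih.1.biUnion fun z _ => hΨ z),
          Set.union_subset ih.2 (Set.iUnion₂_subset fun z _ => hΨX z)⟩
    have h0 : A ∪ K ⊆ ⋃ n, a n := Set.subset_iUnion a 0
    refine ⟨⋃ n, a n, ⟨⟨Set.countable_iUnion fun n => (ha n).1,
      Set.iUnion_subset fun n => (ha n).2⟩, Set.subset_union_right.trans h0, ?_⟩,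
      Set.subset_union_left.trans h0⟩
    intro z hz
    obtain ⟨n, hn⟩ := Set.mem_iUnion.1 hz
    have h1 : Ψ z ⊆ a (n + 1) :=
      (Set.subset_biUnion_of_mem (u := Ψ) hn).trans Set.subset_union_right
    exact h1.trans (Set.subset_iUnion a (n + 1))
  closed c hc _ := by
    refine ⟨⟨Set.countable_iUnion fun n => (hc n).1.1, Set.iUnion_subset fun n => (hc n).1.2⟩,
      (hc 0).2.1.trans (Set.subset_iUnion c 0), fun z hz => ?_⟩
    obtain ⟨n, hn⟩ := Set.mem_iUnion.1 hz
    exact ((hc n).2.2 z hn).trans (Set.subset_iUnion c n)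

/-! ### The models that are used -/

/-- The models of `S` that contain all extension relations and are closed under `α ↦ f α` and
under taking codes for complements. -/
def closedModels (f : Ordinal.{u} → ℕ → ℕ) (S : Set (Set ZFSet.{u})) :
    Set (Set ZFSet.{u}) :=
  {M | M ∈ S ∧ (∀ (N : ℕ) (D : Finset (Fin N)), relSet (extRel D) ∈ M) ∧
    (∀ α : Ordinal.{u}, α.toZFSet ∈ M → realSet (f α) ∈ M) ∧
    ∀ (m : ℕ) (x : ℕ → ℕ), realSet x ∈ M → realSet (complCode m x) ∈ M}

variable {κ : Cardinal.{u}} {f : Ordinal.{u} → ℕ → ℕ} {S : Set (Set ZFSet.{u})}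

/-- By stationarity, every real lies in a model with the required closure properties. -/
lemma exists_mem_closedModels (hκ : 𝔠 < κ) (hS : IsStationaryCountable (HSet κ) S)
    (x : ℕ → ℕ) : ∃ M ∈ closedModels f S, realSet x ∈ M := by
  have hH : ∀ z : ZFSet.{u}, #(trcl z) ≤ 𝔠 → z ∈ HSet κ := fun z hz =>
    hz.trans_lt (by simpa using Cardinal.lift_lt.{u, u + 1}.2 hκ)
  let K : Set ZFSet.{u} := insert (realSet x)
    (Set.range fun p : Σ N : ℕ, Finset (Fin N) => relSet (extRel p.2))
  let Ψ : ZFSet.{u} → Set ZFSet.{u} := fun z =>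
    (fun α => realSet (f α)) '' (toZFSet ⁻¹' {z}) ∪
      ⋃ m, (fun y => realSet (complCode m y)) '' (realSet ⁻¹' {z})
  have hΨ : ∀ z, (Ψ z).Countable := fun z =>
    (((Set.countable_singleton z).preimage_of_injOn toZFSet_injective.injOn).image _).union
      (Set.countable_iUnion fun m =>
        ((Set.countable_singleton z).preimage_of_injOn realSet_injective.injOn).image _)
  have hΨX : ∀ z, Ψ z ⊆ HSet κ := by
    rintro z _ (⟨α, -, rfl⟩ | h)
    · exact hH _ (mk_trcl_realSet _)
    · obtain ⟨m, y, -, rfl⟩ := Set.mem_iUnion.1 h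
      exact hH _ (mk_trcl_realSet _)
  have hKX : K ⊆ HSet κ := by
    rintro _ (rfl | ⟨p, rfl⟩)
    · exact hH _ (mk_trcl_realSet _)
    · exact hH _ (mk_trcl_relSet _)
  obtain ⟨M, hMS, -, hKM, hΨM⟩ := hS _
    (isClubCountable_closed ((Set.countable_range _).insert _) hKX hΨ hΨX)
  refine ⟨M, ⟨hMS, fun N D => hKM (Or.inr ⟨⟨N, D⟩, rfl⟩), fun α hα => ?_, fun m y hy => ?_⟩,
    hKM (Or.inl rfl)⟩
  · exact hΨM _ hα (Or.inl ⟨α, rfl, rfl⟩)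
  · exact hΨM _ hy (Or.inr (Set.mem_iUnion.2 ⟨m, y, rfl, rfl⟩))

/-! ### The recursive construction of the ultrafilters -/

/-- The sets added at height `α`: the diagonal sets along `f α` of the sequences of members
of `V` with a code in some model of height `α`. -/
def added (f : Ordinal.{u} → ℕ → ℕ) (T : Set (Set ZFSet.{u})) (α : Ordinal.{u})
    (V : Ultrafilter ℕ) : Set (Set ℕ) :=
  {B | ∃ M ∈ T, height M = α ∧ ∃ x, realSet x ∈ M ∧ (∀ n, slice x n ∈ V) ∧ B = diag x (f α)}

/-- The filter generated by the cofinite sets and by what is added at the heights below `δ`. -/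
def stageFilter (f : Ordinal.{u} → ℕ → ℕ) (T : Set (Set ZFSet.{u}))
    (δ : Ordinal.{u}) (V : Set.Iio δ → Ultrafilter ℕ) : Filter ℕ :=
  cofinite ⊓ generate (⋃ α : Set.Iio δ, added f T α (V α))

open Classical in
/-- An ultrafilter including the stage filter at `δ` of the ultrafilters at smaller heights
(an arbitrary one if that filter is improper). -/
noncomputable def stage (f : Ordinal.{u} → ℕ → ℕ) (T : Set (Set ZFSet.{u}))
    (δ : Ordinal.{u}) : Ultrafilter ℕ :=
  let F := stageFilter f T δ fun α => stage f T α
  if h : F.NeBot then @Ultrafilter.of ℕ F h else pure 0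
termination_by δ
decreasing_by exact α.2

lemma stage_le {T : Set (Set ZFSet.{u})} {δ : Ordinal.{u}}
    (h : (stageFilter f T δ fun α => stage f T α).NeBot) :
    (stage f T δ : Filter ℕ) ≤ stageFilter f T δ fun α => stage f T α := by
  rw [stage, dif_pos h]
  exact Ultrafilter.of_le _

lemma diag_mem_stageFilter {T : Set (Set ZFSet.{u})} {δ : Ordinal.{u}} {M : Set ZFSet.{u}}
    (hM : M ∈ T) (hδ : height M < δ) {x : ℕ → ℕ} (hx : realSet x ∈ M)
    (hV : ∀ n, slice x n ∈ stage f T (height M)) :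
    diag x (f (height M)) ∈ stageFilter f T δ fun α => stage f T α :=
  mem_inf_of_right (mem_generate_of_mem
    (Set.mem_iUnion.2 ⟨⟨height M, hδ⟩, M, hM, rfl, x, hx, hV, rfl⟩))

/-- Finitely many diagonal sets, listed by nondecreasing height, have infinite intersection. This
is where the pathway is used: with `δ` the greatest height, the diagonal sets of smaller heights
and the finite parts of the sequences of height `δ` belong to the nonprincipal ultrafilter
`stage δ`, so the hypothesis of `extRel` holds, and all the reals that it speaks of lie in
the given models, the functions `f α` with `α < δ` being elements of the last one. -/
lemma infinite_of_monotone {lt : HSet κ → HSet κ → Prop} (h : IsMultiplePathway κ lt f S) {N : ℕ}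
    {M : Fin (N + 1) → Set ZFSet.{u}} (hM : ∀ i, M i ∈ closedModels f S)
    (hmono : Monotone fun i => height (M i))
    (hne : (stageFilter f (closedModels f S) (height (M (Fin.last N)))
      fun α => stage f (closedModels f S) α).NeBot)
    {x : Fin (N + 1) → ℕ → ℕ} (hx : ∀ i, realSet (x i) ∈ M i)
    (hV : ∀ i n, slice (x i) n ∈ stage f (closedModels f S) (height (M i))) :
    {k | ∀ i, k ∈ diag (x i) (f (height (M i)))}.Infinite := by
  classical
  set δ := height (M (Fin.last N)) with hδ
  have hle : ∀ i, height (M i) ≤ δ := fun i => hmono (Fin.le_last i)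
  let D : Finset (Fin (N + 1)) := Finset.univ.filter fun i => height (M i) = δ
  have hD : ∀ {i}, i ∈ D ↔ height (M i) = δ := by simp [D]
  -- The second half of the arguments of `extRel D` must consist of reals in the last model; for
  -- `i ∈ D` its value is irrelevant.
  let y : Fin (N + 1) → ℕ → ℕ := fun i =>
    if i ∈ D then x (Fin.last N) else f (height (M i))
  have hy : ∀ i, realSet (y i) ∈ M (Fin.last N) := by
    intro i
    by_cases hi : i ∈ D
    · simpa [y, hi] using hx (Fin.last N)
    · have hlt : height (M i) < δ := lt_of_le_of_ne (hle i) fun e => hi (hD.2 e)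
      have hmem : (height (M i)).toZFSet ∈ M (Fin.last N) :=
        (not_not.1 (notMem_of_lt_csInf' hlt)).2
      simpa [y, hi] using (hM (Fin.last N)).2.2.1 _ hmem
  let v : Fin (N + 1 + (N + 1)) → ℕ → ℕ := Fin.append x y
  let M' : Fin (N + 1 + (N + 1)) → Set ZFSet.{u} := Fin.append M fun _ => M (Fin.last N)
  have hlast : M' (Fin.last (N + 1 + N)) = M (Fin.last N) := by
    have : Fin.last (N + 1 + N) = Fin.natAdd (N + 1) (Fin.last N) := rfl
    rw [this]
    exact Fin.append_right _ _ _
  have key := h.rel (N + 1 + N) M' ?_ ?_ (extRel D) (isProjective_extRel D) (isAdequate_extRel D)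
    ?_ v ?_
  · rw [hlast, ← hδ] at key
    have hvx : ∀ i, v (Fin.castAdd (N + 1) i) = x i := Fin.append_left x y
    have hvy : ∀ i ∉ D, v (Fin.natAdd (N + 1) i) = f (height (M i)) := fun i hi =>
      (Fin.append_right x y i).trans (if_neg hi)
    have hold : oldSet D v = {k | ∀ i ∉ D, k ∈ diag (x i) (f (height (M i)))} := by
      ext k
      exact forall₂_congr fun i hi => by rw [hvx, hvy i hi]
    have hVle := stage_le hne
    refine (snoc_mem_extRel.1 key fun n => ?_).mono ?_
    · have hmem : {k | k ∈ oldSet D v ∧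
          ∀ i ∈ D, ∀ m ≤ n, k ∈ slice (v (Fin.castAdd (N + 1) i)) m} ∈
            stage f (closedModels f S) δ := by
        rw [hold]
        simp only [hvx]
        refine Filter.Eventually.and ?_ ?_
        · refine eventually_all.2 fun i => ?_
          by_cases hi : i ∈ D
          · exact Eventually.of_forall fun k h => absurd hi h
          · have hlt : height (M i) < δ := lt_of_le_of_ne (hle i) fun e => hi (hD.2 e)
            filter_upwards [hVle (diag_mem_stageFilter (hM i) hlt (hx i) (hV i))] with k hk _
            exact hk
        · refine (eventually_all_finset D).2 fun i hi => ?_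
          refine (eventually_all_finite (Set.finite_Iic n)).2 fun m _ => ?_
          have := hV i m
          rwa [hD.1 hi] at this
      intro hfin
      obtain ⟨k, hk, hk'⟩ := nonempty_of_mem
        (inter_mem hmem ((hVle.trans inf_le_left) hfin.compl_mem_cofinite))
      exact hk' hk
    · rintro k ⟨hk, hkD⟩ i
      by_cases hi : i ∈ D
      · have := hkD i hi
        rwa [hvx, ← hD.1 hi] at this
      · rw [hold] at hk
        exact hk i hi
  · intro i
    refine Fin.addCases (m := N + 1) (n := N + 1) (fun j => ?_) (fun j => ?_) i
    · simpa only [M', Fin.append_left] using (hM j).1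
    · simpa only [M', Fin.append_right] using (hM (Fin.last N)).1
  · have h1 : ∀ i, height (M' i) ≤ δ := fun i => by
      refine Fin.addCases (m := N + 1) (n := N + 1) (fun j => ?_) (fun j => ?_) i
      · simpa only [M', Fin.append_left] using hle j
      · simp only [M', Fin.append_right, le_refl, δ]
    intro i j
    refine Fin.addCases (m := N + 1) (n := N + 1) (fun j' => ?_) (fun j' => ?_) j
    · refine Fin.addCases (m := N + 1) (n := N + 1) (fun i' => ?_) (fun i' => ?_) i
      · intro hij
        simp only [M', Fin.append_left]
        exact hmono hij
      · intro hij
        simp only [Fin.le_def, Fin.val_natAdd, Fin.val_castAdd] at hij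
        omega
    · intro _
      simpa only [M', Fin.append_right] using h1 i
  · rw [hlast]
    exact (hM _).2.1 _ D
  · intro i
    refine Fin.addCases (m := N + 1) (n := N + 1) (fun j => ?_) (fun j => ?_) i
    · simpa only [M', v, Fin.append_left] using hx j
    · simpa only [M', v, Fin.append_right] using hy j

lemma stageFilter_neBot {lt : HSet κ → HSet κ → Prop} (h : IsMultiplePathway κ lt f S)
    (δ : Ordinal.{u}) :
    (stageFilter f (closedModels f S) δ fun α => stage f (closedModels f S) α).NeBot := by
  induction δ using WellFoundedLT.induction with
  | _ δ ih =>
    refine inf_neBot_iff.2 fun {s} hs {s'} hs' => ?_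
    obtain ⟨t, hts, ht, hts'⟩ := mem_generate_iff.1 hs'
    suffices hinf : (⋂₀ t).Infinite by
      obtain ⟨k, hk, hks⟩ := (hinf.sdiff (mem_cofinite.1 hs)).nonempty
      exact ⟨k, not_not.1 hks, hts' hk⟩
    have hdata : ∀ B : t, ∃ M ∈ closedModels f S, height M < δ ∧ ∃ x, realSet x ∈ M ∧
        (∀ n, slice x n ∈ stage f (closedModels f S) (height M)) ∧
        (B : Set ℕ) = diag x (f (height M)) := by
      intro B
      obtain ⟨⟨_, hδ⟩, M, hM, rfl, x, hx, hV, hB⟩ := Set.mem_iUnion.1 (hts B.2)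
      exact ⟨M, hM, hδ, x, hx, hV, hB⟩
    choose M hM hMδ x hx hV hB using hdata
    have := ht.to_subtype
    obtain ⟨n, ⟨e⟩⟩ := Finite.exists_equiv_fin t
    have heq : ∀ e' : Fin n ≃ t,
        ⋂₀ t = {k | ∀ i, k ∈ diag (x (e' i)) (f (height (M (e' i))))} := by
      intro e'
      ext k
      simp only [Set.mem_sInter, Set.mem_ofPred_eq, ← hB]
      exact ⟨fun hk i => hk _ (e' i).2, fun hk B hBt => by simpa using hk (e'.symm ⟨B, hBt⟩)⟩
    cases n with
    | zero =>
      rw [heq e.symm]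
      simpa using Set.infinite_univ
    | succ n =>
      -- The pathway speaks of models listed by nondecreasing height.
      let e' := (Tuple.sort fun i => height (M (e.symm i))).trans e.symm
      rw [heq e']
      exact infinite_of_monotone h (fun i => hM _)
        (Tuple.monotone_sort fun i => height (M (e.symm i))) (ih _ (hMδ _)) (fun i => hx _)
        fun i => hV _

end DPathway

theorem mainTheorem2
    (h : ∃ (κ : Cardinal.{u}) (lt : DPathway.HSet κ → DPathway.HSet κ → Prop)
      (f : Ordinal.{u} → ℕ → ℕ) (S : Set (Set ZFSet.{u})),
      DPathway.IsMultiplePathway κ lt f S) :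
    ∃ U : Ultrafilter ℕ, DPathway.IsPPoint U := by
  open DPathway in
  obtain ⟨κ, lt, f, S, h⟩ := h
  set T := closedModels f S with hT
  -- A stage above all heights sees every diagonal set.
  obtain ⟨δ, hδ⟩ : ∃ δ : Ordinal.{u}, ∀ M : Set ZFSet.{u}, height M < δ := by
    refine ⟨Order.succ ω₁, fun M => Order.lt_succ_of_le (csInf_le' ?_)⟩
    simp
  have hle := stage_le (stageFilter_neBot h δ)
  have hcof : (stage f T δ : Filter ℕ) ≤ cofinite := hle.trans inf_le_left
  refine ⟨stage f T δ, hcof, fun F hF hFU => ?_⟩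
  rcases F.eq_empty_or_nonempty with rfl | hne
  · exact ⟨Set.univ, univ_mem, by simp⟩
  obtain ⟨A, rfl⟩ := hF.exists_eq_range hne
  obtain ⟨x, hxA⟩ := exists_slice_eq A
  obtain ⟨M, hM, hxM⟩ := exists_mem_closedModels (f := f) h.continuum_lt h.stationary x
  have hdiag : ∀ z : ℕ → ℕ, realSet z ∈ M → (∀ n, slice z n ∈ stage f T (height M)) →
      diag z (f (height M)) ∈ stage f T δ := fun z hz hV =>
    hle (diag_mem_stageFilter hM (hδ M) hz hV)
  -- If a member of the family were not in the ultrafilter at the height of `M`, then the diagonal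
  -- set of its constant complement would be in the final ultrafilter and almost disjoint from it.
  have hV : ∀ n, slice x n ∈ stage f T (height M) := by
    intro m
    by_contra hm
    rw [← Ultrafilter.compl_mem_iff_notMem] at hm
    have h1 := hdiag (complCode m x) (hM.2.2.2 m x hxM) fun n => by rwa [slice_complCode]
    have h2 := hcof (diag_diff_slice_finite (complCode m x) (f (height M)) 0).compl_mem_cofinite
    have h3 : slice x m ∈ stage f T δ := hxA m ▸ hFU _ ⟨m, rfl⟩
    rw [slice_complCode] at h2
    obtain ⟨k, ⟨hk1, hk2⟩, hk3⟩ := nonempty_of_mem (inter_mem (inter_mem h1 h2) h3)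
    exact hk2 ⟨hk1, not_not.2 hk3⟩
  refine ⟨diag x (f (height M)), hdiag x hxM hV, ?_⟩
  rintro _ ⟨m, rfl⟩
  rw [← hxA m]
  exact diag_diff_slice_finite _ _ _
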